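/- Let $d\ge 1$, $1\le p<\infty$, write $|A|$ for the Lebesgue measure of $A\subset\mathbb R^d$, $c_d=|B(0,1)|$ and $\eta(r)=(r/c_d)^{1/d}$. Let $\nu:\mathbb R^d\setminus\{0\}\to[0,\infty]$ be measurable. Its symmetric rearrangement has the radial profile $$\nu^*(\rho)=\inf\{s>0:\ |\{\nu>s\}|\le c_d\rho^d\},\qquad \rho\in[0,\infty],$$ and we put $$\nu^\#(r)=\int_{\{\nu<\nu^*(\eta(r))\}}\nu(h)\,dh,\qquad w(r)=\big(r\,\nu^\#(r)\big)^{1/p}\quad(0<r<\infty),\qquad w(0)=0,\quad w(\infty)=\infty .$$ Assume that $w:[0,\infty]\to[0,\infty]$ is bijective with inverse $w^{-1}$, and let $\phi(t)=1/w^{-1}(1/t)$ for $t\in[0,\infty]$ (with $1/0=\infty$, $1/\infty=0$). Assume further that $\phi_p(t)=\phi(t^{1/p})$ is a Young function, i.e. $\phi_p:[0,\infty]\to[0,\infty]$ is convex with $\phi_p(0)=0$, and that for some $\theta\in(0,\infty)$ $$\phi\Big(\theta\,\frac st\Big)\le\frac{\phi(s)}{\phi(t)}\qquad\text{for all } 0\le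 s\le t,\ 0<t<\infty .$$ For real $t\ge 2$ put $$C_p(t)=\frac{t^p-2}{t^p-1},\qquad \Theta_t=t\,\Big[2\,C_p(t)\,\phi\Big(\frac{\theta}{t}\Big)\Big]^{-1/p}$$ (so $\Theta_t=\infty$ exactly when $p=1$ and $t=2$; the convention $\infty\cdot 0=0$ is used below). Let $L^\phi(\mathbb R^d)$ be the set of measurable $u:\mathbb R^d\to\mathbb R$ with $\int_{\mathbb R^d}\phi(|u(x)|/\lambda)\,dx<\infty$ for some $\lambda>0$, and let $$\|u\|_{L^\phi(\mathbb R^d)}=\inf\Big\{\lambda>0:\ \int_{\mathbb R^d}\phi\Big(\frac{|u(x)|}{\lambda}\Big)dx\le 1\Big\}.$$ Then for every $t\ge2$ and every $u\in L^\phi(\mathbb R^d)$ $$\|u\|_{L^\phi(\mathbb R^d)}\le\Theta_t\Big(\int_{\mathbb R^d}\int_{\mathbb R^d}|u(x)-u(y)|^p\,\nu(x-y)\,dy\,dx\Big)^{1/p},$$ where the right-hand side may be $+\infty$. -/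

import Mathlib

open MeasureTheory
open scoped ENNReal NNReal

noncomputable section

/-- The volume `c_d = |B(0,1)|` of the unit ball of `ℝ^d`. -/
def unitBallVolume (d : ℕ) : ℝ≥0∞ :=
  volume (Metric.ball (0 : EuclideanSpace ℝ (Fin d)) 1)

/-- The radius `η(r) = (r / c_d)^{1/d}` of a ball of volume `r`. -/
def ballRadius (d : ℕ) (r : ℝ≥0∞) : ℝ≥0∞ :=
  (r / unitBallVolume d) ^ (1 / (d : ℝ))

/-- The radial profile of the symmetric rearrangement of `ν`:
`ν^*(ρ) = inf {s > 0 : |{ν > s}| ≤ c_d ρ^d}`. -/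
def symmRearrangement {d : ℕ} (ν : EuclideanSpace ℝ (Fin d) → ℝ≥0∞) (ρ : ℝ≥0∞) : ℝ≥0∞ :=
  sInf {s : ℝ≥0∞ | 0 < s ∧ volume {h | s < ν h} ≤ unitBallVolume d * ρ ^ d}

/-- `ν^#(r) = ∫_{ν < ν^*(η(r))} ν(h) dh`. -/
def nuSharp {d : ℕ} (ν : EuclideanSpace ℝ (Fin d) → ℝ≥0∞) (r : ℝ≥0∞) : ℝ≥0∞ :=
  ∫⁻ h in {h | ν h < symmRearrangement ν (ballRadius d r)}, ν h

/-- `w(r) = (r ν^#(r))^{1/p}` on `[0, ∞]`. At the endpoints the product `r ν^#(r)` may be of the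
form `0 · ∞`; there `w(0) = 0` and `w(∞) = ∞`. -/
def wFun {d : ℕ} (ν : EuclideanSpace ℝ (Fin d) → ℝ≥0∞) (p : ℝ) (r : ℝ≥0∞) : ℝ≥0∞ :=
  if r = ∞ then ∞ else (r * nuSharp ν r) ^ (1 / p)

/-- The critical function `φ(t) = 1 / w⁻¹(1 / t)`, with `w⁻¹` the inverse of the bijection `w` of
`[0, ∞]`, and `1 / 0 = ∞`, `1 / ∞ = 0`. -/
def criticalFunction {d : ℕ} (ν : EuclideanSpace ℝ (Fin d) → ℝ≥0∞) (p : ℝ)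
    (hw : Function.Bijective (wFun ν p)) (t : ℝ≥0∞) : ℝ≥0∞ :=
  ((Equiv.ofBijective (wFun ν p) hw).symm t⁻¹)⁻¹

/-- A Young function: a convex function `ψ : [0, ∞] → [0, ∞]` with `ψ(0) = 0`. -/
def IsYoungFunction (ψ : ℝ≥0∞ → ℝ≥0∞) : Prop :=
  ConvexOn ℝ≥0 Set.univ ψ ∧ ψ 0 = 0

/-- `u ∈ L^ψ(ℝ^d)`: `u` is Lebesgue measurable and `∫ ψ(|u| / l) < ∞` for some `0 < l < ∞`. -/
def MemOrlicz {d : ℕ} (ψ : ℝ≥0∞ → ℝ≥0∞) (u : EuclideanSpace ℝ (Fin d) → ℝ) : Prop :=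
  AEMeasurable u volume ∧ ∃ l : ℝ≥0∞, 0 < l ∧ l < ∞ ∧ ∫⁻ x, ψ (‖u x‖ₑ / l) < ∞

/-- The Luxemburg norm `inf {l > 0 : ∫ ψ(|u| / l) ≤ 1}`. -/
def luxemburgNorm {d : ℕ} (ψ : ℝ≥0∞ → ℝ≥0∞) (u : EuclideanSpace ℝ (Fin d) → ℝ) : ℝ≥0∞ :=
  sInf {l : ℝ≥0∞ | 0 < l ∧ l < ∞ ∧ ∫⁻ x, ψ (‖u x‖ₑ / l) ≤ 1}

/-- `|u|_{W^p_ν} = (∬ |u(x) - u(y)|^p ν(x - y) dy dx)^{1/p}`. -/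
def nonlocalSeminorm {d : ℕ} (ν : EuclideanSpace ℝ (Fin d) → ℝ≥0∞) (p : ℝ)
    (u : EuclideanSpace ℝ (Fin d) → ℝ) : ℝ≥0∞ :=
  (∫⁻ x, ∫⁻ y, ‖u x - u y‖ₑ ^ p * ν (x - y)) ^ (1 / p)

/-- `C_p(t) = (t^p - 2) / (t^p - 1)`. -/
def constC (p t : ℝ) : ℝ := (t ^ p - 2) / (t ^ p - 1)

/-- `Θ_t = t [2 C_p(t) ψ(θ / t)]^{-1/p}`, with value `∞` if `C_p(t) = 0`. -/
def constTheta (ψ : ℝ≥0∞ → ℝ≥0∞) (p : ℝ) (θ : ℝ≥0) (t : ℝ) : ℝ≥0∞ :=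
  ENNReal.ofReal t *
    (2 * ENNReal.ofReal (constC p t) * ψ (θ / ENNReal.ofReal t)) ^ (-(1 / p))

end

/-! The argument slices a function along geometric levels. Let `v ≥ 0` be bounded with `{v > 0}` of
finite measure; put `a i = |{v > t^i}|`, `δ i = |{t^i < v ≤ t^(i+1)}|`, `q = t^p`, `W i = w(a i)`,
and let `E` be the energy, i.e. the `p`-th power of the seminorm of `v`. The proof is the chain
`φ(θ/t) ∑ q^(i+1) (W i)^p ≤ ∑ q^i a_i ν#(a_(i-1)) ≤ (1 - 1/q)⁻¹ ∑ q^i δ_i ν#(a_(i-1)) ≤ (1 - 1/q)⁻¹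
q E / 2`.

The last inequality holds because two points two layers apart differ in value by at least `t^(i-1)`,
while a set of measure `r` leaves at least `ν#(r)` of the mass of `ν` outside it
(`nuSharp_le_lintegral_compl`, `two_mul_tsum_levelLayer_le_energy`). The middle one is summation by
parts (`tsum_zpow_mul_le_of_le_tsum`). The first one is Jensen's inequality for `φ_p` with weights
`q^i (W (i-1))^p`, after the growth condition has been used at the levels `a i ≤ a (i-1)`
(`criticalFunction_mul_tsum_le`).

Once `∑ q^(i+1) (W i)^p ≤ l^p`, convexity and `φ(1/w(r)) = 1/r` bound the modular of `v/l` by `1`. A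
general `u` is reached by truncation and Fatou's lemma. -/

/-! ### Geometric sums, supporting lines and Young functions. -/

/-- The sum of the powers `q ^ i` over the integers `i ≤ l`. -/
theorem ENNReal.tsum_zpow_le_eq {q : ℝ≥0∞} (hq1 : 1 < q) (hq : q ≠ ∞) (l : ℤ) :
    ∑' i : ℤ, (if i ≤ l then q ^ i else 0) = q ^ l * (1 - q⁻¹)⁻¹ := by
  have hq0 : q ≠ 0 := (zero_lt_one.trans hq1).ne'
  have hinj : Function.Injective (fun n : ℕ => l - (n : ℤ)) := by
    intro a b h
    simpa using h
  have hsupp : Function.support (fun i : ℤ => if i ≤ l then q ^ i else 0) ⊆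
      Set.range (fun n : ℕ => l - (n : ℤ)) := by
    intro i hi
    have h : i ≤ l := by
      by_contra h
      simp [h] at hi
    exact ⟨(l - i).toNat, by simp only; omega⟩
  rw [← hinj.tsum_eq hsupp, ← ENNReal.tsum_geometric, ← ENNReal.tsum_mul_left]
  refine tsum_congr fun n => ?_
  have h : l - (n : ℤ) ≤ l := by omega
  rw [if_pos h, sub_eq_add_neg, ENNReal.zpow_add hq0 hq, ENNReal.zpow_neg, zpow_natCast,
    ENNReal.inv_pow]

/-- A convex function on `[0, ∞)` has a supporting line at every interior point. -/
theorem ConvexOn.exists_supporting_line {f : ℝ → ℝ} (hf : ConvexOn ℝ (Set.Ici 0) f) {x₀ : ℝ}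
    (hx₀ : 0 < x₀) : ∃ c, ∀ x, 0 ≤ x → f x₀ + c * (x - x₀) ≤ f x := by
  set R : Set ℝ := (fun y => (f y - f x₀) / (y - x₀)) '' Set.Ioi x₀ with hR
  have hne : R.Nonempty := Set.nonempty_Ioi.image _
  have hlow : ∀ x, 0 ≤ x → x < x₀ → ∀ m ∈ R, (f x₀ - f x) / (x₀ - x) ≤ m := by
    rintro x hx hlt _ ⟨y, hy, rfl⟩
    exact hf.slope_mono_adjacent (Set.mem_Ici.2 hx)
      (Set.mem_Ici.2 (hx₀.le.trans (le_of_lt hy))) hlt hy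
  have hbdd : BddBelow R := ⟨_, fun m hm => hlow 0 le_rfl hx₀ m hm⟩
  -- The slope is the right derivative at `x₀`, finite because every left slope bounds the right
  -- slopes from below.
  refine ⟨sInf R, fun x hx => ?_⟩
  rcases lt_trichotomy x x₀ with h | h | h
  · have h1 := le_csInf hne (hlow x hx h)
    rw [div_le_iff₀ (sub_pos.2 h)] at h1
    linarith
  · simp [h]
  · have h1 := csInf_le hbdd ⟨x, h, rfl⟩
    rw [le_div_iff₀ (sub_pos.2 h)] at h1
    linarith

theorem IsYoungFunction.mul_le {ψ : ℝ≥0∞ → ℝ≥0∞} (hψ : IsYoungFunction ψ) {a : ℝ≥0∞}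
    (ha : a ≤ 1) (x : ℝ≥0∞) : ψ (a * x) ≤ a * ψ x := by
  lift a to ℝ≥0 using (ha.trans_lt ENNReal.one_lt_top).ne
  have ha' : a ≤ 1 := by exact_mod_cast ha
  have h := hψ.1.2 (Set.mem_univ x) (Set.mem_univ 0) (zero_le (a := a)) (zero_le (a := 1 - a))
    (add_tsub_cancel_of_le ha')
  simpa [ENNReal.smul_def, hψ.2] using h

/-- Scaling down from `y` handles finite `y`. It says nothing about `y = ∞`, hence the separate
condition there. -/
theorem IsYoungFunction.monotone {ψ : ℝ≥0∞ → ℝ≥0∞} (hψ : IsYoungFunction ψ) (h0 : ψ ∞ = ∞) :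
    Monotone ψ := by
  intro x y hxy
  rcases eq_or_ne y ∞ with rfl | hy
  · simp [h0]
  rcases eq_or_ne y 0 with rfl | hy0
  · simp [nonpos_iff_eq_zero.1 hxy]
  have h1 : x / y ≤ 1 := ENNReal.div_le_of_le_mul (by simpa using hxy)
  calc ψ x = ψ (x / y * y) := by rw [ENNReal.div_mul_cancel hy0 hy]
    _ ≤ x / y * ψ y := hψ.mul_le h1 y
    _ ≤ 1 * ψ y := by gcongr
    _ = ψ y := one_mul _

/-- A finite Young function has a supporting line at every positive finite point. -/
theorem IsYoungFunction.exists_supporting_line {ψ : ℝ≥0∞ → ℝ≥0∞} (hψ : IsYoungFunction ψ)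
    (hfin : ∀ x, x ≠ ∞ → ψ x ≠ ∞) {x₀ : ℝ≥0∞} (hx₀ : x₀ ≠ 0) (hx₀' : x₀ ≠ ∞) :
    ∃ c : ℝ≥0∞, c ≠ ∞ ∧ ∀ x, x ≠ ∞ → ψ x₀ + c * x ≤ ψ x + c * x₀ := by
  set f : ℝ → ℝ := fun x => (ψ (ENNReal.ofReal x)).toReal with hf
  have hconv : ConvexOn ℝ (Set.Ici 0) f := by
    refine ⟨convex_Ici 0, fun x hx y hy a b ha hb hab => ?_⟩
    have h := hψ.1.2 (Set.mem_univ (ENNReal.ofReal x)) (Set.mem_univ (ENNReal.ofReal y))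
      (zero_le (a := a.toNNReal)) (zero_le (a := b.toNNReal))
      (by rw [← Real.toNNReal_add ha hb, hab, Real.toNNReal_one])
    simp only [ENNReal.smul_def, smul_eq_mul] at h
    have e : ENNReal.ofReal (a * x + b * y) =
        (a.toNNReal : ℝ≥0∞) * ENNReal.ofReal x + (b.toNNReal : ℝ≥0∞) * ENNReal.ofReal y := by
      rw [ENNReal.ofReal_add (mul_nonneg ha hx) (mul_nonneg hb hy), ENNReal.ofReal_mul ha,
        ENNReal.ofReal_mul hb]
      rfl
    have hx' := hfin (ENNReal.ofReal x) ENNReal.ofReal_ne_top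
    have hy' := hfin (ENNReal.ofReal y) ENNReal.ofReal_ne_top
    simp only [hf, smul_eq_mul]
    rw [e]
    refine (ENNReal.toReal_mono (by finiteness) h).trans_eq ?_
    rw [ENNReal.toReal_add (by finiteness) (by finiteness), ENNReal.toReal_mul,
      ENNReal.toReal_mul]
    simp [ha, hb]
  obtain ⟨c, hc⟩ := hconv.exists_supporting_line (ENNReal.toReal_pos hx₀ hx₀')
  -- The line lies below `f 0 = 0` at the origin, so `c * x₀ ≥ f x₀ ≥ 0`.
  have hc0 : 0 ≤ c := by
    have h := hc 0 le_rfl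
    have h0 : f 0 = 0 := by simp [hf, hψ.2]
    have h1 : 0 ≤ f x₀.toReal := ENNReal.toReal_nonneg
    have h2 := ENNReal.toReal_pos hx₀ hx₀'
    by_contra hneg
    nlinarith
  refine ⟨ENNReal.ofReal c, ENNReal.ofReal_ne_top, fun x hx => ?_⟩
  have h := hc x.toReal ENNReal.toReal_nonneg
  simp only [hf, ENNReal.ofReal_toReal hx, ENNReal.ofReal_toReal hx₀'] at h
  have hψx := hfin x hx
  have hψx₀ := hfin x₀ hx₀'
  rw [← ENNReal.toReal_le_toReal (by finiteness) (by finiteness),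
    ENNReal.toReal_add (by finiteness) (by finiteness),
    ENNReal.toReal_add (by finiteness) (by finiteness), ENNReal.toReal_mul, ENNReal.toReal_mul,
    ENNReal.toReal_ofReal hc0]
  linarith

/-! ### The bathtub principle for `ν^#`. -/

theorem unitBallVolume_ne_zero (d : ℕ) : unitBallVolume d ≠ 0 :=
  (Metric.measure_ball_pos volume _ one_pos).ne'

theorem unitBallVolume_ne_top (d : ℕ) : unitBallVolume d ≠ ∞ :=
  measure_ball_lt_top.ne

theorem unitBallVolume_mul_ballRadius_pow {d : ℕ} (hd : 1 ≤ d) (r : ℝ≥0∞) :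
    unitBallVolume d * ballRadius d r ^ d = r := by
  rw [ballRadius, ← ENNReal.rpow_mul_natCast, one_div_mul_cancel (by positivity),
    ENNReal.rpow_one, ENNReal.mul_div_cancel (unitBallVolume_ne_zero d) (unitBallVolume_ne_top d)]

theorem symmRearrangement_ballRadius {d : ℕ} (hd : 1 ≤ d)
    (ν : EuclideanSpace ℝ (Fin d) → ℝ≥0∞) (r : ℝ≥0∞) :
    symmRearrangement ν (ballRadius d r) = sInf {s : ℝ≥0∞ | 0 < s ∧ volume {h | s < ν h} ≤ r} := by
  rw [symmRearrangement, unitBallVolume_mul_ballRadius_pow hd]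

theorem nuSharp_anti {d : ℕ} (hd : 1 ≤ d) (ν : EuclideanSpace ℝ (Fin d) → ℝ≥0∞) :
    Antitone (nuSharp ν) := by
  intro r r' h
  refine lintegral_mono_set fun x (hx : ν x < _) => hx.trans_le ?_
  rw [symmRearrangement_ballRadius hd, symmRearrangement_ballRadius hd]
  exact sInf_le_sInf fun s hs => ⟨hs.1, hs.2.trans h⟩

theorem nullMeasurableSet_lt_const {α : Type*} [MeasurableSpace α] {μ : Measure α} {f : α → ℝ≥0∞}
    (hf : AEMeasurable f μ) (s : ℝ≥0∞) : NullMeasurableSet {x | s < f x} μ :=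
  hf.nullMeasurable measurableSet_Ioi

/-- Continuity from above along levels increasing to `S`; finiteness at `s₀` is what permits it. -/
theorem measure_le_setOf_sInf_le {α : Type*} [MeasurableSpace α] {μ : Measure α} {f : α → ℝ≥0∞}
    (hf : AEMeasurable f μ) {r S : ℝ≥0∞} (hlt : ∀ s, 0 < s → s < S →
      r < μ {x | s < f x}) {s₀ : ℝ≥0∞} (h0 : 0 < s₀) (hs₀ : s₀ < S) (hfin : μ {x | s₀ < f x} ≠ ∞) :
    r ≤ μ {x | S ≤ f x} := by
  obtain ⟨σ, hmono, hmem, hlim⟩ := exists_seq_strictMono_tendsto' hs₀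
  have hset : {x | S ≤ f x} = ⋂ n, {x | σ n < f x} := by
    ext x
    simp only [Set.mem_ofPred_eq, Set.mem_iInter]
    exact ⟨fun h n => (hmem n).2.trans_le h, fun h => le_of_tendsto' hlim fun n => (h n).le⟩
  have hanti : Antitone fun n => {x | σ n < f x} :=
    fun m n h x (hx : σ n < f x) => (hmono.monotone h).trans_lt hx
  have ht := tendsto_measure_iInter_atTop (μ := μ)
    (fun n => nullMeasurableSet_lt_const hf (σ n)) hanti
    ⟨0, ne_top_of_le_ne_top hfin (measure_mono fun x (hx : σ 0 < f x) => (hmem 0).1.trans hx)⟩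
  rw [hset]
  exact ge_of_tendsto' ht fun n => (hlt _ (h0.trans (hmem n).1) (hmem n).2).le

theorem lintegral_inter_add_sdiff₀ {α : Type*} [MeasurableSpace α] {μ : Measure α} (f : α → ℝ≥0∞)
    (s : Set α) {t : Set α} (ht : NullMeasurableSet t μ) :
    (∫⁻ x in s ∩ t, f x ∂μ) + ∫⁻ x in s \ t, f x ∂μ = ∫⁻ x in s, f x ∂μ := by
  rw [← lintegral_add_measure, Measure.restrict_inter_add_sdiff₀ s ht]

/-- Among the sets of given measure, the integral of `ν` over the complement is at least `ν^#`. -/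
theorem nuSharp_le_lintegral_compl {d : ℕ} (hd : 1 ≤ d) {ν : EuclideanSpace ℝ (Fin d) → ℝ≥0∞}
    (hν : AEMeasurable ν volume) {F : Set (EuclideanSpace ℝ (Fin d))}
    (hF : NullMeasurableSet F volume) (hFfin : volume F ≠ ∞) :
    nuSharp ν (volume F) ≤ ∫⁻ h in Fᶜ, ν h := by
  rw [nuSharp, symmRearrangement_ballRadius hd]
  set r := volume F with hr
  set S := sInf {s : ℝ≥0∞ | 0 < s ∧ volume {h | s < ν h} ≤ r} with hSdef
  have hlt : ∀ s, 0 < s → s < S → r < volume {x | s < ν x} := by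
    intro s hs hsS
    by_contra hcon
    exact hsS.not_ge (sInf_le ⟨hs, not_lt.1 hcon⟩)
  set B := {h | ν h < S} with hB
  have hBm : NullMeasurableSet B volume := hν.nullMeasurable measurableSet_Iio
  -- If `{ν ≥ S}` has measure at least `r`, the part of `F` inside `{ν < S}` is no larger than the
  -- part of `{ν ≥ S}` outside `F`, and exchanging the two can only increase the integral. Otherwise
  -- some superlevel set at a positive level below `S` has infinite measure, and so has its part
  -- outside `F`; the right-hand side is then infinite.
  by_cases hcase : r ≤ volume Bᶜ
  · have h1 : volume (F ∩ B) ≤ volume (Bᶜ ∩ Fᶜ) := by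
      have e1 : volume (F ∩ B) + volume (F ∩ Bᶜ) = r := by
        rw [← Set.sdiff_eq]; exact measure_inter_add_sdiff₀ F hBm
      have e2 : volume (Bᶜ ∩ F) + volume (Bᶜ ∩ Fᶜ) = volume Bᶜ := by
        rw [← Set.sdiff_eq Bᶜ F]; exact measure_inter_add_sdiff₀ Bᶜ hF
      have hfin : volume (F ∩ Bᶜ) ≠ ∞ := measure_ne_top_of_subset Set.inter_subset_left hFfin
      rw [← e1, ← e2, Set.inter_comm Bᶜ F, add_comm] at hcase
      exact (ENNReal.add_le_add_iff_left hfin).1 hcase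
    have hle : ∀ A : Set (EuclideanSpace ℝ (Fin d)), S * volume (A ∩ Bᶜ) ≤ ∫⁻ h in A ∩ Bᶜ, ν h := by
      intro A
      rw [← setLIntegral_const]
      refine lintegral_mono_ae ?_
      have hae : ∀ᵐ h ∂(volume.restrict Bᶜ), h ∈ Bᶜ := ae_restrict_mem₀ hBm.compl
      filter_upwards [ae_mono (Measure.restrict_mono Set.inter_subset_right le_rfl) hae] with h hh
      exact not_lt.1 hh
    calc ∫⁻ h in B, ν h = (∫⁻ h in B ∩ F, ν h) + ∫⁻ h in B \ F, ν h :=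
          (lintegral_inter_add_sdiff₀ ν B hF).symm
      _ ≤ S * volume (B ∩ F) + ∫⁻ h in B \ F, ν h := by
          gcongr
          rw [← setLIntegral_const]
          refine lintegral_mono_ae ?_
          have hae : ∀ᵐ h ∂(volume.restrict B), h ∈ B := ae_restrict_mem₀ hBm
          filter_upwards [ae_mono (Measure.restrict_mono Set.inter_subset_left le_rfl) hae] with h hh
          exact le_of_lt hh
      _ ≤ S * volume (Fᶜ ∩ Bᶜ) + ∫⁻ h in B \ F, ν h := by
          rw [Set.inter_comm B F, Set.inter_comm Fᶜ]
          gcongr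
      _ ≤ (∫⁻ h in Fᶜ ∩ Bᶜ, ν h) + ∫⁻ h in B \ F, ν h := by
          gcongr
          exact hle _
      _ = (∫⁻ h in Fᶜ ∩ B, ν h) + ∫⁻ h in Fᶜ \ B, ν h := by
          rw [add_comm, Set.sdiff_eq, Set.sdiff_eq, Set.inter_comm B]
      _ = ∫⁻ h in Fᶜ, ν h := lintegral_inter_add_sdiff₀ ν Fᶜ hBm
  · rcases eq_zero_or_pos S with hS | hS
    · have : B = ∅ := by simp [hB, hS]
      simp [this]
    obtain ⟨s, hs0, hsS⟩ := exists_between hS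
    have htop : volume {x | s < ν x} = ∞ := by
      by_contra hfin
      refine hcase ((measure_le_setOf_sInf_le hν hlt hs0 hsS hfin).trans_eq ?_)
      congr 1
      ext x
      simp [hB]
    have htop' : volume ({x | s < ν x} ∩ Fᶜ) = ∞ := by
      have e := measure_inter_add_sdiff₀ (μ := volume) {x | s < ν x} hF
      rw [htop, ENNReal.add_eq_top] at e
      rcases e with e | e
      · exact absurd e (measure_ne_top_of_subset Set.inter_subset_right hFfin)
      · exact e
    have : ∫⁻ h in Fᶜ, ν h = ∞ := by
      rw [← top_le_iff]
      calc ∞ = s * volume.restrict Fᶜ {x | s ≤ ν x} := by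
            rw [eq_comm, ENNReal.mul_eq_top]
            refine Or.inl ⟨hs0.ne', ?_⟩
            rw [← top_le_iff, ← htop']
            refine (measure_mono (Set.inter_subset_inter_left _ fun x (hx : s < ν x) => hx.le)).trans
              (Measure.le_restrict_apply _ _)
        _ ≤ ∫⁻ h in Fᶜ, ν h := mul_meas_ge_le_lintegral₀ hν.restrict s
    rw [this]
    exact le_top

/-! ### The function `w` and the critical function. -/

section CriticalFunction

variable {d : ℕ} {ν : EuclideanSpace ℝ (Fin d) → ℝ≥0∞} {p : ℝ}

theorem wFun_top : wFun ν p ∞ = ∞ := if_pos rfl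

theorem wFun_zero (hp : 1 ≤ p) : wFun ν p 0 = 0 := by
  simp [wFun, zero_lt_one.trans_le hp]

theorem wFun_rpow (hp : 1 ≤ p) {r : ℝ≥0∞} (hr : r ≠ ∞) : wFun ν p r ^ p = r * nuSharp ν r := by
  rw [wFun, if_neg hr, one_div, ENNReal.rpow_inv_rpow (zero_lt_one.trans_le hp).ne']

theorem wFun_eq_zero_iff (hp : 1 ≤ p) (hw : Function.Bijective (wFun ν p)) {r : ℝ≥0∞} :
    wFun ν p r = 0 ↔ r = 0 :=
  ⟨fun h => hw.1 (h.trans (wFun_zero hp).symm), fun h => by rw [h, wFun_zero hp]⟩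

theorem wFun_eq_top_iff (hw : Function.Bijective (wFun ν p)) {r : ℝ≥0∞} :
    wFun ν p r = ∞ ↔ r = ∞ :=
  ⟨fun h => hw.1 (h.trans wFun_top.symm), fun h => by rw [h, wFun_top]⟩

variable (hw : Function.Bijective (wFun ν p))

theorem criticalFunction_inv_wFun (r : ℝ≥0∞) :
    criticalFunction ν p hw (wFun ν p r)⁻¹ = r⁻¹ := by
  rw [criticalFunction, inv_inv]
  congr 1
  exact (Equiv.ofBijective (wFun ν p) hw).symm_apply_apply r

theorem criticalFunction_zero : criticalFunction ν p hw 0 = 0 := by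
  simpa [wFun_top] using criticalFunction_inv_wFun hw ∞

theorem criticalFunction_top (hp : 1 ≤ p) : criticalFunction ν p hw ∞ = ∞ := by
  simpa [wFun_zero hp] using criticalFunction_inv_wFun hw 0

theorem criticalFunction_bijective : Function.Bijective (criticalFunction ν p hw) :=
  (inv_involutive.bijective.comp (Equiv.ofBijective (wFun ν p) hw).symm.bijective).comp
    inv_involutive.bijective

theorem criticalFunction_monotone (hp : 1 ≤ p)
    (hYoung : IsYoungFunction (fun t : ℝ≥0∞ => criticalFunction ν p hw (t ^ (1 / p)))) :
    Monotone (criticalFunction ν p hw) := by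
  have hp0 : 0 < p := zero_lt_one.trans_le hp
  have hmono := hYoung.monotone (by
    simp [ENNReal.top_rpow_of_pos (inv_pos.2 hp0), criticalFunction_top hw hp])
  intro x y hxy
  have h := hmono (ENNReal.rpow_le_rpow hxy hp0.le)
  simpa only [one_div, ENNReal.rpow_rpow_inv hp0.ne'] using h

theorem criticalFunction_strictMono (hp : 1 ≤ p)
    (hYoung : IsYoungFunction (fun t : ℝ≥0∞ => criticalFunction ν p hw (t ^ (1 / p)))) :
    StrictMono (criticalFunction ν p hw) :=
  (criticalFunction_monotone hw hp hYoung).strictMono_of_injective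
    (criticalFunction_bijective hw).1

theorem criticalFunction_continuous (hp : 1 ≤ p)
    (hYoung : IsYoungFunction (fun t : ℝ≥0∞ => criticalFunction ν p hw (t ^ (1 / p)))) :
    Continuous (criticalFunction ν p hw) :=
  (criticalFunction_monotone hw hp hYoung).continuous_of_surjective
    (criticalFunction_bijective hw).2

theorem criticalFunction_eq_zero_iff {x : ℝ≥0∞} : criticalFunction ν p hw x = 0 ↔ x = 0 :=
  ⟨fun h => (criticalFunction_bijective hw).1 (h.trans (criticalFunction_zero hw).symm),
    fun h => h ▸ criticalFunction_zero hw⟩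

theorem criticalFunction_eq_top_iff (hp : 1 ≤ p) {x : ℝ≥0∞} :
    criticalFunction ν p hw x = ∞ ↔ x = ∞ :=
  ⟨fun h => (criticalFunction_bijective hw).1 (h.trans (criticalFunction_top hw hp).symm),
    fun h => h ▸ criticalFunction_top hw hp⟩

/-- Read off from the monotonicity of `φ` through `φ(1/w(r)) = 1/r`: in the product `r ν^#(r)` one
factor increases and the other decreases. -/
theorem wFun_monotone (hp : 1 ≤ p)
    (hYoung : IsYoungFunction (fun t : ℝ≥0∞ => criticalFunction ν p hw (t ^ (1 / p)))) :
    Monotone (wFun ν p) := by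
  intro r r' h
  rw [← ENNReal.inv_le_inv, ← (criticalFunction_strictMono hw hp hYoung).le_iff_le,
    criticalFunction_inv_wFun, criticalFunction_inv_wFun]
  exact ENNReal.inv_le_inv.2 h

end CriticalFunction

/-! ### Level sets and the energy. -/

section LevelSets

variable {d : ℕ}

/-- Used with `g y = x - y` and with `g x = x - y`, so that `ν` need not be even. -/
theorem nuSharp_le_lintegral_compl_comp (hd : 1 ≤ d) {ν : EuclideanSpace ℝ (Fin d) → ℝ≥0∞}
    (hν : AEMeasurable ν volume) (g : EuclideanSpace ℝ (Fin d) ≃ᵐ EuclideanSpace ℝ (Fin d))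
    (hg : MeasurePreserving g volume volume) {A : Set (EuclideanSpace ℝ (Fin d))}
    (hA : NullMeasurableSet A volume) (hfin : volume A ≠ ∞) :
    nuSharp ν (volume A) ≤ ∫⁻ y in Aᶜ, ν (g y) := by
  have hg' : MeasurePreserving g.symm volume volume := hg.symm g
  have hF := hA.preimage hg'.quasiMeasurePreserving
  have hvol : volume (g.symm ⁻¹' A) = volume A := hg'.measure_preimage hA
  have hpre : g ⁻¹' (g.symm ⁻¹' A)ᶜ = Aᶜ := by
    ext y
    simp
  have h := nuSharp_le_lintegral_compl hd hν hF (by rwa [hvol])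
  rwa [hvol, ← hg.setLIntegral_comp_preimage_emb g.measurableEmbedding, hpre] at h

/-- The dyadic-type layer `{t ^ i < v ≤ t ^ (i + 1)}`. -/
def levelLayer {α : Type*} (v : α → ℝ) (t : ℝ) (i : ℤ) : Set α :=
  {x | t ^ i < v x ∧ v x ≤ t ^ (i + 1)}

theorem nullMeasurableSet_levelLayer {α : Type*} [MeasurableSpace α] {μ : Measure α} {v : α → ℝ}
    (hv : AEMeasurable v μ) (t : ℝ) (i : ℤ) : NullMeasurableSet (levelLayer v t i) μ :=
  hv.nullMeasurable measurableSet_Ioc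

theorem eq_of_mem_levelLayer {α : Type*} {v : α → ℝ} {t : ℝ} (ht : 1 < t) {i j : ℤ} {x : α}
    (hi : x ∈ levelLayer v t i) (hj : x ∈ levelLayer v t j) : i = j := by
  have h1 := (zpow_lt_zpow_iff_right₀ ht).1 (hi.1.trans_le hj.2)
  have h2 := (zpow_lt_zpow_iff_right₀ ht).1 (hj.1.trans_le hi.2)
  omega

theorem exists_mem_levelLayer {α : Type*} {v : α → ℝ} {t : ℝ} (ht : 1 < t) {x : α}
    (hx : 0 < v x) : ∃ i, x ∈ levelLayer v t i :=
  exists_mem_Ioc_zpow hx ht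

theorem tsum_indicator_levelLayer {α : Type*} {v : α → ℝ} {t : ℝ} (ht : 1 < t) {i : ℤ} {x : α}
    (hi : x ∈ levelLayer v t i) (c : ℤ → ℝ≥0∞) :
    ∑' j, (levelLayer v t j).indicator (fun _ => c j) x = c i := by
  rw [tsum_eq_single i, Set.indicator_of_mem hi]
  intro j hj
  exact Set.indicator_of_notMem (fun h => hj (eq_of_mem_levelLayer ht h hi)) _

theorem measure_superlevel_le_tsum {α : Type*} [MeasurableSpace α] (μ : Measure α) (v : α → ℝ)
    {t : ℝ} (ht : 1 < t) (i : ℤ) :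
    μ {x | t ^ i < v x} ≤ ∑' l, if i ≤ l then μ (levelLayer v t l) else 0 := by
  calc μ {x | t ^ i < v x} ≤ μ (⋃ l, if i ≤ l then levelLayer v t l else ∅) := by
        refine measure_mono fun x (hx : t ^ i < v x) => ?_
        obtain ⟨l, hl⟩ := exists_mem_levelLayer ht ((zpow_pos (by linarith) i).trans hx)
        have h := (zpow_lt_zpow_iff_right₀ ht).1 (hx.trans_le hl.2)
        refine Set.mem_iUnion.2 ⟨l, ?_⟩
        rwa [if_pos (by omega)]
    _ ≤ ∑' l, μ (if i ≤ l then levelLayer v t l else ∅) := measure_iUnion_le _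
    _ = _ := by
        refine tsum_congr fun l => ?_
        split_ifs <;> simp

theorem ofReal_zpow_rpow {t : ℝ} (ht : 0 < t) (p : ℝ) (i : ℤ) :
    ENNReal.ofReal (t ^ i) ^ p = (ENNReal.ofReal t ^ p) ^ i := by
  rw [← ENNReal.rpow_intCast, ← ENNReal.rpow_mul, mul_comm p, ENNReal.rpow_mul,
    ENNReal.ofReal_rpow_of_pos ht, Real.rpow_intCast]

/-- Contribution to the energy of the pairs `(x, y)` with `v y < v x`, at fixed `x`. -/
theorem tsum_indicator_levelLayer_le_lintegral {v : EuclideanSpace ℝ (Fin d) → ℝ}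
    (hv : AEMeasurable v volume) (hv0 : ∀ x, 0 ≤ v x) {p t : ℝ} (hp : 1 ≤ p) (ht : 2 ≤ t)
    {k : EuclideanSpace ℝ (Fin d) → ℝ≥0∞} {b : ℤ → ℝ≥0∞}
    (hb : ∀ i : ℤ, b i ≤ ∫⁻ y in {y | t ^ i < v y}ᶜ, k y) (x : EuclideanSpace ℝ (Fin d)) :
    ∑' i, (levelLayer v t i).indicator
      (fun _ => (ENNReal.ofReal t ^ p) ^ (i - 1) * b (i - 1)) x ≤
      ∫⁻ y, {y | v y < v x}.indicator (fun y => ‖v x - v y‖ₑ ^ p * k y) y := by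
  rcases (hv0 x).eq_or_lt with hx | hx
  · have : ∀ i, x ∉ levelLayer v t i := by
      intro i hi
      have h := hi.1
      rw [← hx] at h
      exact h.not_gt (zpow_pos (by linarith) i)
    simp [Set.indicator_of_notMem (this _)]
  obtain ⟨i, hi⟩ := exists_mem_levelLayer (t := t) (by linarith) hx
  rw [tsum_indicator_levelLayer (by linarith) hi, ← ofReal_zpow_rpow (by linarith)]
  set A := {y | t ^ (i - 1) < v y} with hA
  have hAm : NullMeasurableSet A volume := hv.nullMeasurable measurableSet_Ioi
  have hpow : t ^ i = t * t ^ (i - 1) := by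
    rw [mul_comm, zpow_sub_one₀ (by linarith), mul_assoc, inv_mul_cancel₀ (by linarith), mul_one]
  have hpos : 0 < t ^ (i - 1) := zpow_pos (by linarith) _
  calc ENNReal.ofReal (t ^ (i - 1)) ^ p * b (i - 1)
      ≤ ENNReal.ofReal (t ^ (i - 1)) ^ p * ∫⁻ y in Aᶜ, k y := by gcongr; exact hb _
    _ = ∫⁻ y in Aᶜ, ENNReal.ofReal (t ^ (i - 1)) ^ p * k y := by
        rw [lintegral_const_mul' _ _ (by finiteness)]
    _ ≤ ∫⁻ y in Aᶜ, {y | v y < v x}.indicator (fun y => ‖v x - v y‖ₑ ^ p * k y) y := by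
        refine lintegral_mono_ae ?_
        filter_upwards [ae_restrict_mem₀ hAm.compl] with y hy
        have hy' : v y ≤ t ^ (i - 1) := not_lt.1 hy
        -- Here `v x > t^i = t * t^(i-1) ≥ 2 t^(i-1)` and `v y ≤ t^(i-1)`; this is where `t ≥ 2`
        -- enters.
        have hdiff : t ^ (i - 1) ≤ v x - v y := by
          have := hi.1
          nlinarith
        have hlt : v y < v x := by linarith
        rw [Set.indicator_of_mem (by exact hlt), Real.enorm_of_nonneg (by linarith)]
        gcongr
    _ ≤ _ := setLIntegral_le_lintegral _ _

/-- Lower bound of the nonlocal energy by the level sets. -/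
theorem two_mul_tsum_levelLayer_le_energy (hd : 1 ≤ d) {ν : EuclideanSpace ℝ (Fin d) → ℝ≥0∞}
    (hν : AEMeasurable ν volume) {v : EuclideanSpace ℝ (Fin d) → ℝ}
    (hv : AEMeasurable v volume) (hv0 : ∀ x, 0 ≤ v x) {p t : ℝ} (hp : 1 ≤ p) (ht : 2 ≤ t)
    (hfin : ∀ i : ℤ, volume {x | t ^ i < v x} ≠ ∞) :
    2 * ∑' i, (ENNReal.ofReal t ^ p) ^ (i - 1) * nuSharp ν (volume {x | t ^ (i - 1) < v x}) *
      volume (levelLayer v t i) ≤ ∫⁻ x, ∫⁻ y, ‖v x - v y‖ₑ ^ p * ν (x - y) := by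
  set b : ℤ → ℝ≥0∞ := fun i => nuSharp ν (volume {x | t ^ i < v x}) with hb
  have hAm : ∀ i : ℤ, NullMeasurableSet {x | t ^ i < v x} volume :=
    fun i => hv.nullMeasurable measurableSet_Ioi
  have hsum : ∑' i, (ENNReal.ofReal t ^ p) ^ (i - 1) * b (i - 1) * volume (levelLayer v t i) =
      ∫⁻ x, ∑' i, (levelLayer v t i).indicator
        (fun _ => (ENNReal.ofReal t ^ p) ^ (i - 1) * b (i - 1)) x := by
    rw [lintegral_tsum fun i => aemeasurable_const.indicator₀ (nullMeasurableSet_levelLayer hv t i)]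
    exact tsum_congr fun i => (lintegral_indicator_const₀ (nullMeasurableSet_levelLayer hv t i) _).symm
  set K : EuclideanSpace ℝ (Fin d) → EuclideanSpace ℝ (Fin d) → ℝ≥0∞ :=
    fun x y => ‖v x - v y‖ₑ ^ p * ν (x - y) with hK
  have hdown : ∑' i, (ENNReal.ofReal t ^ p) ^ (i - 1) * b (i - 1) * volume (levelLayer v t i) ≤
      ∫⁻ x, ∫⁻ y, {y | v y < v x}.indicator (K x) y := by
    rw [hsum]
    refine lintegral_mono fun x => tsum_indicator_levelLayer_le_lintegral hv hv0 hp ht ?_ x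
    exact fun i => nuSharp_le_lintegral_compl_comp hd hν (MeasurableEquiv.subLeft x)
      (Measure.measurePreserving_sub_left volume x) (hAm i) (hfin i)
  have hup : ∑' i, (ENNReal.ofReal t ^ p) ^ (i - 1) * b (i - 1) * volume (levelLayer v t i) ≤
      ∫⁻ x, ∫⁻ y, {y | v x < v y}.indicator (K x) y := by
    have hmeas : AEMeasurable (Function.uncurry fun x y => {y | v x < v y}.indicator (K x) y)
        (volume.prod volume) := by
      have h1 : AEMeasurable (fun z : EuclideanSpace ℝ (Fin d) × EuclideanSpace ℝ (Fin d) => v z.1)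
          (volume.prod volume) := hv.comp_fst
      have h2 : AEMeasurable (fun z : EuclideanSpace ℝ (Fin d) × EuclideanSpace ℝ (Fin d) => v z.2)
          (volume.prod volume) := hv.comp_snd
      have h3 : AEMeasurable (fun z : EuclideanSpace ℝ (Fin d) × EuclideanSpace ℝ (Fin d) =>
          ν (z.1 - z.2)) (volume.prod volume) :=
        hν.comp_quasiMeasurePreserving (quasiMeasurePreserving_sub_of_right_invariant volume volume)
      exact (((h1.sub h2).enorm.pow_const p).mul h3).indicator₀ (nullMeasurableSet_lt h1 h2)
    -- After Tonelli the upper point `y` is fixed, and the one-point bound applies with the roles of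
    -- `x` and `y` exchanged.
    rw [lintegral_lintegral_swap hmeas, hsum]
    refine lintegral_mono fun y => ?_
    refine (tsum_indicator_levelLayer_le_lintegral hv hv0 hp ht (k := fun x => ν (x - y)) ?_ y).trans
      (lintegral_mono fun x => ?_)
    · exact fun i => nuSharp_le_lintegral_compl_comp hd hν (MeasurableEquiv.subRight y)
        (measurePreserving_sub_right volume y) (hAm i) (hfin i)
    · by_cases h : v x < v y
      · rw [Set.indicator_of_mem (by exact h), Set.indicator_of_mem (by exact h), hK,
          ← enorm_sub_rev]
      · rw [Set.indicator_of_notMem (by exact h)]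
        exact bot_le
  -- The pairs with `v y < v x` and those with `v x < v y` are disjoint, which yields the factor
  -- `2`.
  rw [two_mul]
  calc _ ≤ (∫⁻ x, ∫⁻ y, {y | v y < v x}.indicator (K x) y) +
        ∫⁻ x, ∫⁻ y, {y | v x < v y}.indicator (K x) y := add_le_add hdown hup
    _ ≤ ∫⁻ x, (∫⁻ y, {y | v y < v x}.indicator (K x) y) +
        ∫⁻ y, {y | v x < v y}.indicator (K x) y := le_lintegral_add _ _
    _ ≤ ∫⁻ x, ∫⁻ y, K x y := by
        refine lintegral_mono fun x => (le_lintegral_add _ _).trans (lintegral_mono fun y => ?_)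
        rcases lt_trichotomy (v x) (v y) with h | h | h
        · simp [h, h.not_gt]
        · simp [h]
        · simp [h, h.not_gt]

end LevelSets

/-! ### Summation by parts, Jensen's inequality and the modular bound. -/

/-- Summation by parts for geometric weights. -/
theorem tsum_zpow_mul_le_of_le_tsum {q : ℝ≥0∞} (hq1 : 1 < q) (hq : q ≠ ∞) {a b δ : ℤ → ℝ≥0∞}
    (hb : Monotone b) (ha : ∀ i, a i ≤ ∑' l, if i ≤ l then δ l else 0) :
    ∑' i, q ^ i * a i * b (i - 1) ≤ (1 - q⁻¹)⁻¹ * ∑' l, q ^ l * δ l * b (l - 1) := by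
  -- For `i ≤ l` monotonicity replaces `b (i - 1)` by `b (l - 1)`; after exchanging the sums only a
  -- geometric series in `i ≤ l` remains.
  calc ∑' i, q ^ i * a i * b (i - 1)
      ≤ ∑' i, ∑' l, (if i ≤ l then q ^ i else 0) * (δ l * b (l - 1)) := by
        refine ENNReal.tsum_le_tsum fun i => ?_
        calc q ^ i * a i * b (i - 1)
            ≤ q ^ i * (∑' l, if i ≤ l then δ l else 0) * b (i - 1) := by gcongr; exact ha i
          _ = ∑' l, q ^ i * (if i ≤ l then δ l else 0) * b (i - 1) := by
              rw [← ENNReal.tsum_mul_left, ← ENNReal.tsum_mul_right]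
          _ ≤ _ := by
              refine ENNReal.tsum_le_tsum fun l => ?_
              split_ifs with h
              · rw [mul_assoc]
                gcongr
                exact hb (by omega)
              · simp
    _ = ∑' l, ∑' i, (if i ≤ l then q ^ i else 0) * (δ l * b (l - 1)) := ENNReal.tsum_comm
    _ = (1 - q⁻¹)⁻¹ * ∑' l, q ^ l * δ l * b (l - 1) := by
        rw [← ENNReal.tsum_mul_left]
        refine tsum_congr fun l => ?_
        rw [ENNReal.tsum_mul_right, ENNReal.tsum_zpow_le_eq hq1 hq]
        ring

section CriticalFunction

variable {d : ℕ} {ν : EuclideanSpace ℝ (Fin d) → ℝ≥0∞} {p : ℝ}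
  (hw : Function.Bijective (wFun ν p))

/-- The growth condition, evaluated at two consecutive levels. -/
theorem wFun_rpow_mul_criticalFunction_le (hp : 1 ≤ p)
    (hYoung : IsYoungFunction (fun t : ℝ≥0∞ => criticalFunction ν p hw (t ^ (1 / p))))
    {θ : ℝ≥0}
    (hgrowth : ∀ s t : ℝ≥0, 0 < t → s ≤ t →
      criticalFunction ν p hw ((θ : ℝ≥0∞) * ((s : ℝ≥0∞) / (t : ℝ≥0∞))) ≤
        criticalFunction ν p hw s / criticalFunction ν p hw t)
    {r r' : ℝ≥0∞} (hrr' : r ≤ r') (hr' : r' ≠ ∞) :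
    wFun ν p r' ^ p * criticalFunction ν p hw (θ * (wFun ν p r / wFun ν p r')) ≤
      r * nuSharp ν r' := by
  have hp0 : 0 < p := zero_lt_one.trans_le hp
  rcases eq_or_ne r 0 with rfl | hr0
  · simp [wFun_zero hp, criticalFunction_zero]
  have hr'0 : r' ≠ 0 := fun h => hr0 (nonpos_iff_eq_zero.1 (h ▸ hrr'))
  have hr : r ≠ ∞ := ne_top_of_le_ne_top hr' hrr'
  have hinv : ∀ {ρ : ℝ≥0∞}, ρ ≠ 0 → (wFun ν p ρ)⁻¹ ≠ ∞ := fun h =>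
    ENNReal.inv_ne_top.2 (mt (wFun_eq_zero_iff hp hw).1 h)
  have hpos : 0 < (wFun ν p r)⁻¹ := ENNReal.inv_pos.2 (mt (wFun_eq_top_iff hw).1 hr)
  -- With `s = 1/w(r')` and `t = 1/w(r)` the right-hand side of the growth condition is `r / r'`.
  have h := hgrowth (wFun ν p r')⁻¹.toNNReal (wFun ν p r)⁻¹.toNNReal
    (ENNReal.toNNReal_pos hpos.ne' (hinv hr0))
    (ENNReal.toNNReal_mono (hinv hr0) (ENNReal.inv_le_inv.2 (wFun_monotone hw hp hYoung hrr')))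
  rw [ENNReal.coe_toNNReal (hinv hr0), ENNReal.coe_toNNReal (hinv hr'0),
    criticalFunction_inv_wFun, criticalFunction_inv_wFun, div_eq_mul_inv, div_eq_mul_inv, inv_inv,
    inv_inv, mul_comm (wFun ν p r')⁻¹, ← div_eq_mul_inv] at h
  calc _ ≤ wFun ν p r' ^ p * (r'⁻¹ * r) := by gcongr
    _ = r' * r'⁻¹ * (r * nuSharp ν r') := by rw [wFun_rpow hp hr']; ring
    _ = r * nuSharp ν r' := by rw [ENNReal.mul_inv_cancel hr'0 hr', one_mul]

/-- Finiteness is needed to cancel a multiple of this sum in the Jensen argument. -/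
theorem tsum_zpow_mul_wFun_ne_top (hp : 1 ≤ p)
    (hYoung : IsYoungFunction (fun t : ℝ≥0∞ => criticalFunction ν p hw (t ^ (1 / p))))
    {q : ℝ≥0∞} (hq1 : 1 < q) (hq : q ≠ ∞) {a : ℤ → ℝ≥0∞} {R : ℝ≥0∞} (hR : R ≠ ∞)
    (haR : ∀ i, a i ≤ R) {N : ℤ} (haN : ∀ i, N < i → a i = 0) :
    ∑' i, q ^ i * wFun ν p (a i) ^ p ≠ ∞ := by
  have hp0 : 0 < p := zero_lt_one.trans_le hp
  have hq0 : q ≠ 0 := (zero_lt_one.trans hq1).ne'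
  have hW : wFun ν p R ≠ ∞ := mt (wFun_eq_top_iff hw).1 hR
  have hle : ∑' i, q ^ i * wFun ν p (a i) ^ p ≤
      ∑' i, (if i ≤ N then q ^ i else 0) * wFun ν p R ^ p := by
    refine ENNReal.tsum_le_tsum fun i => ?_
    split_ifs with h
    · gcongr
      exact wFun_monotone hw hp hYoung (haR i)
    · simp [haN i (by omega), wFun_zero hp, hp0]
  refine ne_top_of_le_ne_top ?_ hle
  rw [ENNReal.tsum_mul_right, ENNReal.tsum_zpow_le_eq hq1 hq]
  have h1 : (1 - q⁻¹)⁻¹ ≠ ∞ :=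
    ENNReal.inv_ne_top.2 (tsub_pos_of_lt (ENNReal.inv_lt_one.2 hq1)).ne'
  have h2 := ENNReal.zpow_ne_top hq0 hq N
  have h3 := ENNReal.rpow_ne_top_of_nonneg hp0.le hW
  finiteness

/-- Jensen's inequality for the critical function along the levels. -/
theorem criticalFunction_mul_tsum_le (hp : 1 ≤ p)
    (hYoung : IsYoungFunction (fun t : ℝ≥0∞ => criticalFunction ν p hw (t ^ (1 / p))))
    {θ : ℝ≥0} (hθ : 0 < θ)
    (hgrowth : ∀ s t : ℝ≥0, 0 < t → s ≤ t →
      criticalFunction ν p hw ((θ : ℝ≥0∞) * ((s : ℝ≥0∞) / (t : ℝ≥0∞))) ≤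
        criticalFunction ν p hw s / criticalFunction ν p hw t)
    {T : ℝ≥0∞} (hT1 : 1 < T) (hT : T ≠ ∞) {a : ℤ → ℝ≥0∞} (ha : Antitone a)
    {R : ℝ≥0∞} (hR : R ≠ ∞) (haR : ∀ i, a i ≤ R) {N : ℤ} (haN : ∀ i, N < i → a i = 0) :
    criticalFunction ν p hw (θ / T) * ∑' i, (T ^ p) ^ (i + 1) * wFun ν p (a i) ^ p ≤
      ∑' i, (T ^ p) ^ i * a i * nuSharp ν (a (i - 1)) := by
  have hp0 : 0 < p := zero_lt_one.trans_le hp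
  have hT0 : T ≠ 0 := (zero_lt_one.trans hT1).ne'
  set q := T ^ p with hqdef
  have hq1 : 1 < q := ENNReal.one_lt_rpow hT1 hp0
  have hq : q ≠ ∞ := ENNReal.rpow_ne_top_of_nonneg hp0.le hT
  have hq0 : q ≠ 0 := (zero_lt_one.trans hq1).ne'
  set W : ℤ → ℝ≥0∞ := fun i => wFun ν p (a i) with hW
  set M := ∑' i, q ^ i * W i ^ p with hM
  have hMfin : M ≠ ∞ := tsum_zpow_mul_wFun_ne_top hw hp hYoung hq1 hq hR haR haN
  have hWtop : ∀ i, W i ≠ ∞ := fun i =>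
    mt (wFun_eq_top_iff hw).1 (ne_top_of_le_ne_top hR (haR i))
  have hWmono : ∀ i, W i ≤ W (i - 1) := fun i => wFun_monotone hw hp hYoung (ha (by omega))
  have hM1 : ∑' i, q ^ (i + 1) * W i ^ p = q * M := by
    rw [hM, ← ENNReal.tsum_mul_left]
    refine tsum_congr fun i => ?_
    rw [ENNReal.zpow_add hq0 hq, zpow_one]
    ring
  have hM2 : ∑' i, q ^ i * W (i - 1) ^ p = q * M := by
    rw [← hM1, ← (Equiv.addRight (1 : ℤ)).tsum_eq]
    simp
  set ψ : ℝ≥0∞ → ℝ≥0∞ := fun t => criticalFunction ν p hw (t ^ (1 / p)) with hψ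
  have hψp : ∀ x, ψ (x ^ p) = criticalFunction ν p hw x := by
    intro x
    simp only [hψ, one_div]
    rw [ENNReal.rpow_rpow_inv hp0.ne']
  have hθ0 : (θ : ℝ≥0∞) ≠ 0 := by exact_mod_cast hθ.ne'
  have hx0 : (θ / T) ^ p ≠ 0 :=
    (ENNReal.rpow_pos (ENNReal.div_pos hθ0 hT) (ENNReal.div_ne_top ENNReal.coe_ne_top hT0)).ne'
  have hx0' : (θ / T) ^ p ≠ ∞ :=
    ENNReal.rpow_ne_top_of_nonneg hp0.le (ENNReal.div_ne_top ENNReal.coe_ne_top hT0)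
  -- The point `(θ/T)^p` is the mean of `(θ W i / W (i-1))^p` under the weights `q^i (W (i-1))^p`:
  -- by the index shift `hM2` their total is `q * M`. The linear terms therefore cancel after
  -- summation.
  obtain ⟨c, hc, hline⟩ := hYoung.exists_supporting_line (fun x hx =>
    mt (criticalFunction_eq_top_iff hw hp).1 (ENNReal.rpow_ne_top_of_nonneg (by positivity) hx))
    hx0 hx0'
  have hterm : ∀ i, ψ ((θ / T) ^ p) * (q ^ i * W (i - 1) ^ p) + c * θ ^ p * (q ^ i * W i ^ p) ≤
      q ^ i * a i * nuSharp ν (a (i - 1)) + c * (θ / T) ^ p * (q ^ i * W (i - 1) ^ p) := by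
    intro i
    have hratio : W i / W (i - 1) ≤ 1 := ENNReal.div_le_of_le_mul (by simpa using hWmono i)
    have hx : (θ * (W i / W (i - 1))) ^ p ≠ ∞ := ENNReal.rpow_ne_top_of_nonneg hp0.le
      (ENNReal.mul_ne_top ENNReal.coe_ne_top (ne_top_of_le_ne_top ENNReal.one_ne_top hratio))
    have hl := hline _ hx
    have hcancel : W (i - 1) ^ p * (θ * (W i / W (i - 1))) ^ p = θ ^ p * W i ^ p := by
      rw [← ENNReal.mul_rpow_of_nonneg _ _ hp0.le, ← ENNReal.mul_rpow_of_nonneg _ _ hp0.le]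
      congr 1
      rw [mul_left_comm]
      congr 1
      -- If `W (i-1) = 0`, then `W i = 0` as well, and both sides vanish.
      refine ENNReal.mul_div_cancel' (fun h => ?_) (fun h => absurd h (hWtop _))
      exact nonpos_iff_eq_zero.1 (h ▸ hWmono i)
    have hg := wFun_rpow_mul_criticalFunction_le hw hp hYoung hgrowth
      (ha (by omega : i - 1 ≤ i)) (ne_top_of_le_ne_top hR (haR (i - 1)))
    calc ψ ((θ / T) ^ p) * (q ^ i * W (i - 1) ^ p) + c * θ ^ p * (q ^ i * W i ^ p)
        = q ^ i * W (i - 1) ^ p * (ψ ((θ / T) ^ p) + c * (θ * (W i / W (i - 1))) ^ p) := by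
          rw [mul_add, mul_assoc (q ^ i) _ (c * _), mul_left_comm _ c, hcancel]
          ring
      _ ≤ q ^ i * W (i - 1) ^ p * (ψ ((θ * (W i / W (i - 1))) ^ p) + c * (θ / T) ^ p) := by
          gcongr
      _ = q ^ i * (W (i - 1) ^ p * criticalFunction ν p hw (θ * (W i / W (i - 1)))) +
          c * (θ / T) ^ p * (q ^ i * W (i - 1) ^ p) := by
          rw [hψp]
          ring
      _ ≤ q ^ i * (a i * nuSharp ν (a (i - 1))) +
          c * (θ / T) ^ p * (q ^ i * W (i - 1) ^ p) := by gcongr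
      _ = _ := by rw [mul_assoc (q ^ i)]
  have hsum := ENNReal.tsum_le_tsum hterm
  simp only [ENNReal.tsum_add, ENNReal.tsum_mul_left] at hsum
  rw [hM2, ← hM, hψp] at hsum
  have hb : c * (θ / T) ^ p * (q * M) = c * θ ^ p * M := by
    rw [ENNReal.div_rpow_of_nonneg _ _ hp0.le, ← hqdef]
    calc c * (θ ^ p / q) * (q * M) = c * (θ ^ p / q * q) * M := by ring
      _ = _ := by rw [ENNReal.div_mul_cancel hq0 hq]
  rw [hb] at hsum
  rw [hM1]
  refine (ENNReal.add_le_add_iff_right ?_).1 hsum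
  have : (θ : ℝ≥0∞) ^ p ≠ ∞ := ENNReal.rpow_ne_top_of_nonneg hp0.le ENNReal.coe_ne_top
  finiteness

/-- The modular bound for nonnegative bounded functions whose support has finite measure. -/
theorem lintegral_criticalFunction_le_one_of_bounded (hd : 1 ≤ d) (hp : 1 ≤ p)
    (hν : AEMeasurable ν volume)
    (hYoung : IsYoungFunction (fun t : ℝ≥0∞ => criticalFunction ν p hw (t ^ (1 / p))))
    {θ : ℝ≥0} (hθ : 0 < θ)
    (hgrowth : ∀ s t : ℝ≥0, 0 < t → s ≤ t →
      criticalFunction ν p hw ((θ : ℝ≥0∞) * ((s : ℝ≥0∞) / (t : ℝ≥0∞))) ≤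
        criticalFunction ν p hw s / criticalFunction ν p hw t)
    {t : ℝ} (ht : 2 ≤ t) {v : EuclideanSpace ℝ (Fin d) → ℝ} (hv : AEMeasurable v volume)
    (hv0 : ∀ x, 0 ≤ v x) {C : ℝ} (hvC : ∀ x, v x ≤ C) (hfin : volume {x | 0 < v x} ≠ ∞)
    {l : ℝ≥0∞} (hl0 : l ≠ 0) (hl : l ≠ ∞)
    (hE : ENNReal.ofReal t ^ p * ∫⁻ x, ∫⁻ y, ‖v x - v y‖ₑ ^ p * ν (x - y) ≤
      l ^ p * (2 * (1 - (ENNReal.ofReal t ^ p)⁻¹) *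
        criticalFunction ν p hw (θ / ENNReal.ofReal t))) :
    ∫⁻ x, criticalFunction ν p hw (‖v x‖ₑ / l) ≤ 1 := by
  have hp0 : 0 < p := zero_lt_one.trans_le hp
  have ht0 : 0 < t := by linarith
  set T := ENNReal.ofReal t with hTdef
  have hT1 : 1 < T := by
    rw [hTdef, ENNReal.one_lt_ofReal]
    linarith
  have hT : T ≠ ∞ := ENNReal.ofReal_ne_top
  have hT0 : T ≠ 0 := (zero_lt_one.trans hT1).ne'
  set q := T ^ p with hqdef
  have hq1 : 1 < q := ENNReal.one_lt_rpow hT1 hp0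
  have hq : q ≠ ∞ := ENNReal.rpow_ne_top_of_nonneg hp0.le hT
  have hq0 : q ≠ 0 := (zero_lt_one.trans hq1).ne'
  set φ := criticalFunction ν p hw with hφ
  set a : ℤ → ℝ≥0∞ := fun i => volume {x | t ^ i < v x} with ha
  set δ : ℤ → ℝ≥0∞ := fun i => volume (levelLayer v t i) with hδ
  have hanti : Antitone a := fun i j h => measure_mono fun x (hx : t ^ j < v x) =>
    (zpow_le_zpow_right₀ (by linarith) h).trans_lt hx
  have haR : ∀ i, a i ≤ volume {x | 0 < v x} := fun i =>
    measure_mono fun x (hx : t ^ i < v x) => (zpow_pos ht0 i).trans hx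
  have hafin : ∀ i, a i ≠ ∞ := fun i => ne_top_of_le_ne_top hfin (haR i)
  obtain ⟨n, hn⟩ := pow_unbounded_of_one_lt C (by linarith : 1 < t)
  have haN : ∀ i : ℤ, (n : ℤ) < i → a i = 0 := by
    intro i hi
    have : {x | t ^ i < v x} = ∅ := by
      ext x
      simp only [Set.mem_ofPred_eq, Set.mem_empty_iff_false, iff_false, not_lt]
      refine (hvC x).trans (hn.le.trans ?_)
      rw [← zpow_natCast]
      exact zpow_le_zpow_right₀ (by linarith) hi.le
    simp [ha, this]
  have hjensen := criticalFunction_mul_tsum_le hw hp hYoung hθ hgrowth hT1 hT hanti hfin haR haN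
  rw [← hqdef, ← hφ] at hjensen
  set M := ∑' i, q ^ (i + 1) * wFun ν p (a i) ^ p with hM
  have habel := tsum_zpow_mul_le_of_le_tsum hq1 hq (a := a) (δ := δ)
    (b := fun i => nuSharp ν (a i)) (fun i j h => nuSharp_anti hd ν (hanti h))
    (fun i => measure_superlevel_le_tsum volume v (by linarith) i)
  have henergy := two_mul_tsum_levelLayer_le_energy hd hν hv hv0 hp ht hafin
  rw [← hTdef, ← hqdef] at henergy
  set E := ∫⁻ x, ∫⁻ y, ‖v x - v y‖ₑ ^ p * ν (x - y) with hEdef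
  set κ := 1 - q⁻¹ with hκ
  have hκ0 : κ ≠ 0 := (tsub_pos_of_lt (ENNReal.inv_lt_one.2 hq1)).ne'
  have hκtop : κ ≠ ∞ := ENNReal.sub_ne_top ENNReal.one_ne_top
  have hφ0 : φ (θ / T) ≠ 0 := mt (criticalFunction_eq_zero_iff hw).1
    (ENNReal.div_pos (by exact_mod_cast hθ.ne') hT).ne'
  have hφtop : φ (θ / T) ≠ ∞ := mt (criticalFunction_eq_top_iff hw hp).1
    (ENNReal.div_ne_top ENNReal.coe_ne_top hT0)
  have hMl : M ≤ l ^ p := by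
    have h2 : 2 * ∑' i, q ^ i * δ i * nuSharp ν (a (i - 1)) ≤ q * E := by
      have h1 : ∑' i, q ^ i * δ i * nuSharp ν (a (i - 1)) =
          q * ∑' i, q ^ (i - 1) * nuSharp ν (a (i - 1)) * δ i := by
        rw [← ENNReal.tsum_mul_left]
        refine tsum_congr fun i => ?_
        have : q ^ i = q * q ^ (i - 1) := by
          nth_rw 2 [← zpow_one q]
          rw [← ENNReal.zpow_add hq0 hq, add_sub_cancel]
        rw [this]
        ring
      rw [h1, mul_left_comm]
      exact mul_le_mul' (le_refl q) henergy
    have h3 : M * (2 * κ * φ (θ / T)) ≤ l ^ p * (2 * κ * φ (θ / T)) := by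
      calc M * (2 * κ * φ (θ / T)) = 2 * (κ * (φ (θ / T) * M)) := by ring
        _ ≤ 2 * (κ * (κ⁻¹ * ∑' i, q ^ i * δ i * nuSharp ν (a (i - 1)))) := by
            gcongr 2 * (κ * ?_)
            exact hjensen.trans habel
        _ = 2 * ∑' i, q ^ i * δ i * nuSharp ν (a (i - 1)) := by
            rw [← mul_assoc κ, ENNReal.mul_inv_cancel hκ0 hκtop, one_mul]
        _ ≤ _ := h2.trans hE
    exact (ENNReal.mul_le_mul_iff_left (by simp [hκ0, hφ0]) (by finiteness)).1 h3
  have hlp0 : l ^ p ≠ 0 := (ENNReal.rpow_pos (pos_iff_ne_zero.2 hl0) hl).ne'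
  have hlp : l ^ p ≠ ∞ := ENNReal.rpow_ne_top_of_nonneg hp0.le hl
  have hlevel : ∀ i, φ (ENNReal.ofReal (t ^ (i + 1)) / l) * δ i ≤
      q ^ (i + 1) * wFun ν p (a i) ^ p / l ^ p := by
    intro i
    have hδa : δ i ≤ a i := measure_mono fun x hx => hx.1
    rcases eq_or_ne (a i) 0 with h0 | h0
    · simp [nonpos_iff_eq_zero.1 (h0 ▸ hδa)]
    have hW0 : wFun ν p (a i) ≠ 0 := mt (wFun_eq_zero_iff hp hw).1 h0
    have hWt : wFun ν p (a i) ≠ ∞ := mt (wFun_eq_top_iff hw).1 (hafin i)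
    -- Since `t^(i+1)/l = α^(1/p) / w(a i)` and `α ≤ 1`, convexity gives `φ(t^(i+1)/l) ≤ α φ(1/w(a
    -- i)) = α / a i`; the factor `δ i ≤ a i` then leaves `α`.
    set α := q ^ (i + 1) * wFun ν p (a i) ^ p / l ^ p with hα
    have hα1 : α ≤ 1 := by
      refine ENNReal.div_le_of_le_mul ?_
      rw [one_mul]
      exact (ENNReal.le_tsum i).trans hMl
    have hY := hYoung.mul_le hα1 ((wFun ν p (a i))⁻¹ ^ p)
    have e : (α * (wFun ν p (a i))⁻¹ ^ p) ^ (1 / p) = ENNReal.ofReal (t ^ (i + 1)) / l := by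
      rw [one_div, hα, hqdef, hTdef, ← ofReal_zpow_rpow ht0,
        ← ENNReal.mul_rpow_of_nonneg _ _ hp0.le, ← ENNReal.div_rpow_of_nonneg _ _ hp0.le,
        ← ENNReal.mul_rpow_of_nonneg _ _ hp0.le, ENNReal.rpow_rpow_inv hp0.ne', div_eq_mul_inv,
        div_eq_mul_inv, mul_right_comm, mul_assoc (ENNReal.ofReal _),
        ENNReal.mul_inv_cancel hW0 hWt, mul_one]
    rw [e, one_div, ENNReal.rpow_rpow_inv hp0.ne', hφ, criticalFunction_inv_wFun, ← hφ] at hY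
    calc φ (ENNReal.ofReal (t ^ (i + 1)) / l) * δ i ≤ α * (a i)⁻¹ * a i := by gcongr
      _ = α := by rw [mul_assoc, ENNReal.inv_mul_cancel h0 (hafin i), mul_one]
  calc ∫⁻ x, φ (‖v x‖ₑ / l)
      ≤ ∫⁻ x, ∑' i, (levelLayer v t i).indicator
          (fun _ => φ (ENNReal.ofReal (t ^ (i + 1)) / l)) x := by
        refine lintegral_mono fun x => ?_
        rcases (hv0 x).eq_or_lt with hx | hx
        · simp [← hx, hφ, criticalFunction_zero]
        obtain ⟨i, hi⟩ := exists_mem_levelLayer (t := t) (by linarith) hx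
        rw [tsum_indicator_levelLayer (by linarith) hi, Real.enorm_of_nonneg hx.le]
        refine criticalFunction_monotone hw hp hYoung ?_
        gcongr
        exact hi.2
    _ = ∑' i, φ (ENNReal.ofReal (t ^ (i + 1)) / l) * δ i := by
        rw [lintegral_tsum fun i =>
          aemeasurable_const.indicator₀ (nullMeasurableSet_levelLayer hv t i)]
        exact tsum_congr fun i => lintegral_indicator_const₀ (nullMeasurableSet_levelLayer hv t i) _
    _ ≤ ∑' i, q ^ (i + 1) * wFun ν p (a i) ^ p / l ^ p := ENNReal.tsum_le_tsum hlevel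
    _ = M / l ^ p := by simp only [div_eq_mul_inv, ENNReal.tsum_mul_right, hM]
    _ ≤ 1 := ENNReal.div_le_of_le_mul (by rwa [one_mul])

end CriticalFunction

/-! ### The constant, truncation and passage to the limit. -/

/-- The level set argument yields the larger constant `1 - 1/s` with `s = t^p`; the comparison is `s
(s - 2) ≤ (s - 1)^2`. -/
theorem ofReal_constC_le {p t : ℝ} (hp : 1 ≤ p) (ht : 2 ≤ t) :
    ENNReal.ofReal (constC p t) ≤ 1 - (ENNReal.ofReal t ^ p)⁻¹ := by
  have ht0 : 0 < t := by linarith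
  have hs : 2 ≤ t ^ p := ht.trans (Real.self_le_rpow_of_one_le (by linarith) hp)
  rw [ENNReal.ofReal_rpow_of_pos ht0, ← ENNReal.ofReal_inv_of_pos (by linarith),
    ← ENNReal.ofReal_one, ← ENNReal.ofReal_sub _ (by positivity)]
  refine ENNReal.ofReal_le_ofReal ?_
  rw [constC, div_le_iff₀ (by linarith)]
  have h : t ^ p * (t ^ p)⁻¹ = 1 := mul_inv_cancel₀ (by linarith)
  nlinarith [inv_pos.2 (by linarith : 0 < t ^ p)]

/-- The truncation `min (max (|r| - ε) 0) N`. -/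
def doubleTruncation (ε N r : ℝ) : ℝ := min (max (|r| - ε) 0) N

theorem continuous_doubleTruncation (ε N : ℝ) : Continuous (doubleTruncation ε N) := by
  unfold doubleTruncation
  fun_prop

theorem enorm_doubleTruncation_sub_le (ε N r s : ℝ) :
    ‖doubleTruncation ε N r - doubleTruncation ε N s‖ₑ ≤ ‖r - s‖ₑ := by
  rw [enorm_le_iff_norm_le, Real.norm_eq_abs, Real.norm_eq_abs]
  calc |doubleTruncation ε N r - doubleTruncation ε N s|
      ≤ max |max (|r| - ε) 0 - max (|s| - ε) 0| |N - N| := abs_min_sub_min_le_max _ _ _ _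
    _ = |max (|r| - ε) 0 - max (|s| - ε) 0| := by simp
    _ ≤ |(|r| - ε) - (|s| - ε)| := abs_max_sub_max_le_abs _ _ _
    _ = |(|r| - |s|)| := by rw [sub_sub_sub_cancel_right]
    _ ≤ |r - s| := abs_abs_sub_abs_le _ _

theorem tendsto_doubleTruncation (r : ℝ) :
    Filter.Tendsto (fun n : ℕ => doubleTruncation (1 / ((n : ℝ) + 1)) n r) Filter.atTop
      (nhds |r|) := by
  have h1 : Filter.Tendsto (fun n : ℕ => max (|r| - 1 / ((n : ℝ) + 1)) 0) Filter.atTop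
      (nhds |r|) := by
    have h := (tendsto_const_nhds (x := |r|)).sub (tendsto_one_div_add_atTop_nhds_zero_nat (𝕜 := ℝ))
    have h' := h.max (tendsto_const_nhds (x := (0 : ℝ)))
    simpa using h'
  refine h1.congr' ?_
  filter_upwards [Filter.eventually_ge_atTop ⌈|r|⌉₊] with n hn
  have hn' : |r| ≤ n := Nat.ceil_le.1 hn
  have hpos : (0 : ℝ) ≤ 1 / ((n : ℝ) + 1) := by positivity
  exact (min_eq_left (max_le (by linarith) (Nat.cast_nonneg n))).symm

theorem mainTheorem2 (d : ℕ) (hd : 1 ≤ d) (p : ℝ) (hp : 1 ≤ p)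
    (ν : EuclideanSpace ℝ (Fin d) → ℝ≥0∞) (hν : AEMeasurable ν volume)
    (hw : Function.Bijective (wFun ν p))
    (hYoung : IsYoungFunction (fun t : ℝ≥0∞ => criticalFunction ν p hw (t ^ (1 / p))))
    (θ : ℝ≥0) (hθ : 0 < θ)
    (hgrowth : ∀ s t : ℝ≥0, 0 < t → s ≤ t →
      criticalFunction ν p hw ((θ : ℝ≥0∞) * ((s : ℝ≥0∞) / (t : ℝ≥0∞))) ≤
        criticalFunction ν p hw s / criticalFunction ν p hw t)
    (t : ℝ) (ht : 2 ≤ t)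
    (u : EuclideanSpace ℝ (Fin d) → ℝ) (hu : MemOrlicz (criticalFunction ν p hw) u) :
    luxemburgNorm (criticalFunction ν p hw) u ≤
      constTheta (criticalFunction ν p hw) p θ t * nonlocalSeminorm ν p u := by
  have hp0 : 0 < p := zero_lt_one.trans_le hp
  obtain ⟨hum, l₀, hl₀, hl₀', hint⟩ := hu
  set φ := criticalFunction ν p hw with hφ
  have hcont : Continuous φ := criticalFunction_continuous hw hp hYoung
  refine le_of_forall_gt_imp_ge_of_dense fun l hl => ?_
  rcases eq_or_ne l ∞ with rfl | hltop
  · exact le_top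
  have hl0 : 0 < l := bot_le.trans_lt hl
  refine sInf_le ⟨hl0, hltop.lt_top, ?_⟩
  set E := ∫⁻ x, ∫⁻ y, ‖u x - u y‖ₑ ^ p * ν (x - y) with hEdef
  have hE : ENNReal.ofReal t ^ p * E ≤ l ^ p * (2 * (1 - (ENNReal.ofReal t ^ p)⁻¹) *
      φ (θ / ENNReal.ofReal t)) := by
    rcases eq_or_ne E 0 with h0 | h0
    · simp [h0]
    have hT : ENNReal.ofReal t ≠ 0 := by simpa using (by linarith : 0 < t)
    set B := 2 * ENNReal.ofReal (constC p t) * φ (θ / ENNReal.ofReal t) with hB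
    have hBtop : B ≠ ∞ := by
      have : φ (θ / ENNReal.ofReal t) ≠ ∞ := mt (criticalFunction_eq_top_iff hw hp).1
        (ENNReal.div_ne_top ENNReal.coe_ne_top hT)
      finiteness
    have h1 : ENNReal.ofReal t ^ p * E / B ≤ l ^ p := by
      have h := ENNReal.rpow_le_rpow hl.le hp0.le
      rwa [constTheta, nonlocalSeminorm, ← hB, ← hEdef, ENNReal.mul_rpow_of_nonneg _ _ hp0.le,
        ENNReal.mul_rpow_of_nonneg _ _ hp0.le, one_div, ENNReal.rpow_neg, ENNReal.inv_rpow,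
        ENNReal.rpow_inv_rpow hp0.ne', ENNReal.rpow_inv_rpow hp0.ne', mul_right_comm,
        ← div_eq_mul_inv] at h
    -- When `C_p(t) = 0` the bound is infinite for positive energy, which a finite `l` cannot
    -- exceed.
    have hB0 : B ≠ 0 := by
      intro hB0
      rw [hB0, ENNReal.div_zero
        (mul_ne_zero (ENNReal.rpow_pos (pos_iff_ne_zero.2 hT) ENNReal.ofReal_ne_top).ne' h0),
        top_le_iff] at h1
      exact ENNReal.rpow_ne_top_of_nonneg hp0.le hltop h1
    rw [ENNReal.div_le_iff hB0 hBtop] at h1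
    refine h1.trans ?_
    rw [hB]
    gcongr
    exact ofReal_constC_le hp ht
  set v : ℕ → EuclideanSpace ℝ (Fin d) → ℝ :=
    fun n x => doubleTruncation (1 / ((n : ℝ) + 1)) n (u x) with hv
  have hvm : ∀ n, AEMeasurable (v n) volume := fun n =>
    (continuous_doubleTruncation _ _).measurable.comp_aemeasurable hum
  have hbound : ∀ n, ∫⁻ x, φ (‖v n x‖ₑ / l) ≤ 1 := by
    intro n
    have hε : (0 : ℝ) < 1 / ((n : ℝ) + 1) := by positivity
    refine lintegral_criticalFunction_le_one_of_bounded hw hd hp hν hYoung hθ hgrowth ht (hvm n)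
      (fun x => le_min (le_max_right _ _) (Nat.cast_nonneg n)) (fun x => min_le_right _ _) ?_
      hl0.ne' hltop (le_trans ?_ hE)
    -- On `{v n > 0}` one has `|u| > 1/(n+1)`, so Chebyshev's inequality for the finite modular at
    -- `l₀` bounds its measure.
    · set ε := φ (ENNReal.ofReal (1 / ((n : ℝ) + 1)) / l₀) with hεdef
      have hε0 : ε ≠ 0 := mt (criticalFunction_eq_zero_iff hw).1
        (ENNReal.div_pos (ENNReal.ofReal_pos.2 hε).ne' hl₀'.ne).ne'
      have hmeas : AEMeasurable (fun x => φ (‖u x‖ₑ / l₀)) volume :=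
        hcont.measurable.comp_aemeasurable (hum.enorm.div_const _)
      have hfin : volume {x | ε ≤ φ (‖u x‖ₑ / l₀)} ≠ ∞ := by
        intro htop
        have h := (mul_meas_ge_le_lintegral₀ hmeas ε).trans_lt hint
        rw [htop, ENNReal.mul_top hε0] at h
        exact lt_irrefl _ h
      refine ne_top_of_le_ne_top hfin (measure_mono fun x (hx : 0 < v n x) => ?_)
      refine criticalFunction_monotone hw hp hYoung ?_
      rw [← ofReal_norm, Real.norm_eq_abs]
      gcongr
      rcases lt_max_iff.1 (lt_min_iff.1 hx).1 with h | h
      · linarith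
      · exact absurd h (lt_irrefl _)
    · rw [hEdef]
      gcongr
      exact enorm_doubleTruncation_sub_le _ _ _ _
  have hlim : ∀ x, Filter.Tendsto (fun n => φ (‖v n x‖ₑ / l)) Filter.atTop
      (nhds (φ (‖u x‖ₑ / l))) := by
    intro x
    have h := (tendsto_doubleTruncation (u x)).enorm
    have e : ‖(|u x|)‖ₑ = ‖u x‖ₑ := by rw [← Real.norm_eq_abs, enorm_norm]
    rw [e] at h
    exact (hcont.tendsto _).comp (ENNReal.Tendsto.div_const h (Or.inr hl0.ne'))
  calc ∫⁻ x, φ (‖u x‖ₑ / l)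
      = ∫⁻ x, Filter.liminf (fun n => φ (‖v n x‖ₑ / l)) Filter.atTop :=
        lintegral_congr fun x => (hlim x).liminf_eq.symm
    _ ≤ Filter.liminf (fun n => ∫⁻ x, φ (‖v n x‖ₑ / l)) Filter.atTop :=
        lintegral_liminf_le' fun n =>
          hcont.measurable.comp_aemeasurable ((hvm n).enorm.div_const _)
    _ ≤ Filter.liminf (fun _ : ℕ => (1 : ℝ≥0∞)) Filter.atTop :=
        Filter.liminf_le_liminf (Filter.Eventually.of_forall hbound)
    _ = 1 := Filter.liminf_const 1
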